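/- **Setting.** A standard Borel space is a measurable space isomorphic to a Borel subset of a Polish space with its Borel $\sigma$-algebra; a standard Borel probability space $(\Omega,\mathcal B_\Omega,P_\Omega)$ is a standard Borel space with a probability measure. Let $\mathbb{SBP}_0$ be the category of standard Borel probability spaces in which a morphism $\Omega\to\Omega'$ is an equivalence class $[q]$ of measurable measure-preserving maps $q$ modulo almost-sure equality. For a standard Borel space $A$ let $\mathsf{RV}(A)$ be the presheaf on $\mathbb{SBP}_0$ for which $\mathsf{RV}(A)(\Omega)$ is the set of measurable maps $X:\Omega\to A$ modulo $P_\Omega$-almost-sure equality, with $[X]\cdot[q]=[X\circ q]$. *Atomic sheaves.* A presheaf $P$ on a category $\mathcal C$ is an atomic sheaf if for every $c:Y\to X$ and every $y\in P(Y)$ such that $y\cdot d=y\cdot e$ whenever $c\circ d=c\circ e$, there is a unique $x\in P(X)$ with $x\cdot c=y$. *Supports.* A representable factorisation of $x\in P(X)$ is a triple $(Y,q,y)$ with $q:X\to Y$, $y\in P(Y)$ and $y\cdot q=x$. It is a support of $x$ if for every representable factorisation $(Y',q',y')$ of $x$ there is a unique $r:Y'\to Y$ with $r\circ q'=q$ and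 $y\cdot r=y'$. The presheaf $P$ has supports if every element of every $P(X)$ has a support. *Conditional independence.* Let $X:\Omega\to A$, $Y:\Omega\to B$, $Z:\Omega\to C$ be random variables with values in standard Borel spaces, and let $P_Z$ be the law of $Z$. A disintegration of $P_\Omega$ along $Z$ is a Markov kernel $(z,S)\mapsto P_\Omega(S\mid Z=z)$ from $C$ to $\Omega$ with $P_\Omega(Z^{-1}(z)\mid Z=z)=1$ for $P_Z$-almost all $z$ and $P_\Omega(S)=\int_C P_\Omega(S\mid Z=z)\,dP_Z(z)$ for all $S\in\mathcal B_\Omega$. We write $X\perp Y\mid Z$ if, for such a disintegration, for all measurable $S\subseteq A$ and $T\subseteq B$ and for $P_Z$-almost all $z$, $$P_\Omega(X^{-1}(S)\cap Y^{-1}(T)\mid Z=z)=P_\Omega(X^{-1}(S)\mid Z=z)\,P_\Omega(Y^{-1}(T)\mid Z=z).$$ A commuting square $[r]\circ[p]=[s]\circ[q]$ in $\mathbb{SBP}_0$ is independent if $p\perp q\mid r\circ p$. *Atomic conditional independence.* For presheaves $\underline A,\underline B,\underline C$ on $\mathbb{SBP}_0$, the set $\perp_{\underline A,\underline B|\underline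 C}(\Omega)$ consists of all $(x,y,z)\in(\underline A\times\underline B\times\underline C)(\Omega)$ for which there are an independent square formed by $p:\Omega\to\Omega_x$, $q:\Omega\to\Omega_y$, $r:\Omega_x\to\Omega_z$, $s:\Omega_y\to\Omega_z$ (so $r\circ p=s\circ q$) and elements $(x',u')\in(\underline A\times\underline C)(\Omega_x)$, $(y',v')\in(\underline B\times\underline C)(\Omega_y)$, $z'\in\underline C(\Omega_z)$ with $x'\cdot p=x$, $y'\cdot q=y$, $z'\cdot r=u'$, $z'\cdot s=v'$, such that $(\Omega_z,\,r\circ p,\,z')$ is a support of $z$. **Proposition 8.6.** The category $\mathbb{SBP}_0$ is essentially small, and every cospan in it can be completed to a commuting square, so that the topos $\mathrm{Sh}_{\mathrm{at}}(\mathbb{SBP}_0)$ of atomic sheaves is defined. Moreover: 1. For every standard Borel space $A$, the presheaf $\mathsf{RV}(A)$ is an atomic sheaf and has supports. 2. For all standard Borel spaces $A,B,C$, the sets $\perp_{\mathsf{RV}(A),\mathsf{RV}(B)|\mathsf{RV}(C)}(\Omega)$ form a subsheaf of $\mathsf{RV}(A)\times\mathsf{RV}(B)\times\mathsf{RV}(C)$.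 For every standard Borel probability space $\Omega$ and all random variables $X:\Omega\to A$, $Y:\Omega\to B$, $Z:\Omega\to C$, $$([X],[Y],[Z])\in{\perp_{\mathsf{RV}(A),\mathsf{RV}(B)|\mathsf{RV}(C)}}(\Omega)\iff X\perp Y\mid Z.$$ -/

import Mathlib

universe u v w

open CategoryTheory Opposite MeasureTheory ProbabilityTheory

namespace AtomicSheaves

variable {C : Type v} [Category.{w} C]

/-- Given `c : Y ⟶ X`, an element `y ∈ P(Y)` is `c`-invariant if `y · d = y · e` for every parallel
pair `d, e : Z ⟶ Y` with `c ∘ d = c ∘ e`. -/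
def IsInvariant (P : Cᵒᵖ ⥤ Type u) {X Y : C} (c : Y ⟶ X) (y : P.obj (op Y)) : Prop :=
  ∀ ⦃Z : C⦄ (d e : Z ⟶ Y), d ≫ c = e ≫ c → P.map d.op y = P.map e.op y

/-- `P` is a sheaf for the atomic topology: for every map `c : Y ⟶ X`, every `c`-invariant
`y ∈ P(Y)` is `x · c` for a unique `x ∈ P(X)`. -/
def IsAtomicSheaf (P : Cᵒᵖ ⥤ Type u) : Prop :=
  ∀ ⦃X Y : C⦄ (c : Y ⟶ X) (y : P.obj (op Y)), IsInvariant P c y →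
    ∃! x : P.obj (op X), P.map c.op x = y

/-- A family of subsets of the values of `P` determines a subsheaf of `P`: it is closed under
restriction, and the resulting subpresheaf is an atomic sheaf. -/
def IsSubsheaf (P : Cᵒᵖ ⥤ Type u) (Q : ∀ X : C, Set (P.obj (op X))) : Prop :=
  ∃ G : Subfunctor P, IsAtomicSheaf G.toFunctor ∧ ∀ X : C, G.obj (op X) = Q X

/-- A representable factorisation `x = elt · map` of `x ∈ P(X)`. -/
structure RepFactorisation (P : Cᵒᵖ ⥤ Type u) {X : C} (x : P.obj (op X)) where
  obj : C
  map : X ⟶ obj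
  elt : P.obj (op obj)
  fac : P.map map.op elt = x

/-- A representable factorisation is a support if it is terminal among all representable
factorisations of the same element. -/
def RepFactorisation.IsSupport {P : Cᵒᵖ ⥤ Type u} {X : C} {x : P.obj (op X)}
    (F : RepFactorisation P x) : Prop :=
  ∀ G : RepFactorisation P x, ∃! r : G.obj ⟶ F.obj, G.map ≫ r = F.map ∧ P.map r.op F.elt = G.elt

/-- Every element has a support. -/
def HasSupports (P : Cᵒᵖ ⥤ Type u) : Prop :=
  ∀ ⦃X : C⦄ (x : P.obj (op X)), ∃ F : RepFactorisation P x, F.IsSupport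

/-- A collection of squares
```
  X --p--> Y
  |        |
  q        r
  v        v
  Z --s--> W
```
in a category. -/
def SquareClass (C : Type v) [Category.{w} C] : Type (max v w) :=
  ∀ ⦃X Y Z W : C⦄, (X ⟶ Y) → (X ⟶ Z) → (Y ⟶ W) → (Z ⟶ W) → Prop

/-- Atomic conditional independence of `x` and `y` given `z`, relative to a class `Ind` of
independent commuting squares: there are an independent square `r ∘ p = s ∘ q` out of `X` and
elements `(x', u') ∈ (A × D)(X₁)`, `(y', v') ∈ (B × D)(X₂)`, `z' ∈ D(X₃)` such that `x' · p = x`,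
`y' · q = y`, `z' · r = u'`, `z' · s = v'`, and `(X₃, r ∘ p, z')` is a support for `z`. -/
def AtomicCondIndep (Ind : SquareClass C) (A B D : Cᵒᵖ ⥤ Type u) {X : C}
    (x : A.obj (op X)) (y : B.obj (op X)) (z : D.obj (op X)) : Prop :=
  ∃ (X₁ X₂ X₃ : C) (p : X ⟶ X₁) (q : X ⟶ X₂) (r : X₁ ⟶ X₃) (s : X₂ ⟶ X₃), Ind p q r s ∧
    ∃ (x' : A.obj (op X₁)) (u' : D.obj (op X₁)) (y' : B.obj (op X₂)) (v' : D.obj (op X₂))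
      (z' : D.obj (op X₃)),
      A.map p.op x' = x ∧ B.map q.op y' = y ∧ D.map r.op z' = u' ∧ D.map s.op z' = v' ∧
      ∃ h : D.map (p ≫ r).op z' = z,
        RepFactorisation.IsSupport (⟨X₃, p ≫ r, z', h⟩ : RepFactorisation D z)

/-- The family of subsets `X ↦ {(x, y, z) | x and y are independent given z}` of `A × B × D`. -/
def atomicCondIndepSet (Ind : SquareClass C) (A B D : Cᵒᵖ ⥤ Type u) (X : C) :
    Set ((FunctorToTypes.prod A (FunctorToTypes.prod B D)).obj (op X)) :=
  {t | AtomicCondIndep Ind A B D t.1 t.2.1 t.2.2}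

end AtomicSheaves

namespace ProbabilitySheaves

section RandomVariables

variable {Ω A B D : Type*} [MeasurableSpace Ω] [MeasurableSpace A] [MeasurableSpace B]
  [MeasurableSpace D]

/-- A disintegration of `P` along the random variable `Z`: a Markov kernel `K`, where `K z S` is
written `P(S | Z = z)`, concentrated on the fibres of `Z` and averaging to `P` over the law of
`Z`. -/
structure IsDisintegration (P : Measure Ω) (Z : Ω → D) (K : Kernel D Ω) : Prop where
  isMarkov : IsMarkovKernel K
  fibre : ∀ᵐ z ∂(P.map Z), K z (Z ⁻¹' {z}) = 1
  average : ∀ S : Set Ω, MeasurableSet S → P S = ∫⁻ z, K z S ∂(P.map Z)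

/-- Conditional independence of the random variables `X` and `Y` given `Z`, in terms of a
disintegration along `Z` (on standard Borel spaces one exists and it is almost surely unique). -/
def CondIndepRV (P : Measure Ω) (X : Ω → A) (Y : Ω → B) (Z : Ω → D) : Prop :=
  ∃ K : Kernel D Ω, IsDisintegration P Z K ∧
    ∀ (S : Set A) (T : Set B), MeasurableSet S → MeasurableSet T →
      ∀ᵐ z ∂(P.map Z), K z (X ⁻¹' S ∩ Y ⁻¹' T) = K z (X ⁻¹' S) * K z (Y ⁻¹' T)

end RandomVariables

/-- Almost sure equality of random variables. -/
def rvSetoid {Ω : Type u} [MeasurableSpace Ω] (P : Measure Ω) (A : Type u) [MeasurableSpace A] :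
    Setoid {X : Ω → A // Measurable X} where
  r X Y := X.1 =ᵐ[P] Y.1
  iseqv := ⟨fun _ => Filter.EventuallyEq.rfl, fun h => h.symm, fun h k => h.trans k⟩

/-- Almost sure equality of measure preserving maps. -/
def mapSetoid {Ω Ω' : Type u} [MeasurableSpace Ω] [MeasurableSpace Ω'] (P : Measure Ω)
    (P' : Measure Ω') : Setoid {q : Ω → Ω' // MeasurePreserving q P P'} where
  r p q := p.1 =ᵐ[P] q.1
  iseqv := ⟨fun _ => Filter.EventuallyEq.rfl, fun h => h.symm, fun h k => h.trans k⟩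

/-- Standard Borel probability spaces, the objects of the category `SBP₀`. -/
structure SBP₀ : Type (u + 1) where
  carrier : Type u
  [measurableSpace : MeasurableSpace carrier]
  [standardBorel : StandardBorelSpace carrier]
  P : Measure carrier
  [isProbability : IsProbabilityMeasure P]

attribute [instance] SBP₀.measurableSpace SBP₀.standardBorel SBP₀.isProbability

/-- Morphisms of `SBP₀`: measure preserving maps modulo almost sure equality. -/
def SBP₀.Hom (Ω Ω' : SBP₀.{u}) : Type u := _root_.Quotient (mapSetoid Ω.P Ω'.P)

/-- The class of a measure preserving map. -/
def SBP₀.homMk {Ω Ω' : SBP₀.{u}} (q : Ω.carrier → Ω'.carrier) (hq : MeasurePreserving q Ω.P Ω'.P) :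
    SBP₀.Hom Ω Ω' :=
  Quotient.mk (mapSetoid Ω.P Ω'.P) ⟨q, hq⟩

/-- `[q] ∘ [p] = [q ∘ p]`, written in diagrammatic order. -/
def SBP₀.comp {Ω Ω' Ω'' : SBP₀.{u}} : SBP₀.Hom Ω Ω' → SBP₀.Hom Ω' Ω'' → SBP₀.Hom Ω Ω'' :=
  Quotient.map₂ (fun p q => ⟨q.1 ∘ p.1, q.2.comp p.2⟩) fun p p' hp q q' hq => by
    have h1 : q.1 ∘ p.1 =ᵐ[Ω.P] q'.1 ∘ p.1 := p.2.quasiMeasurePreserving.ae_eq_comp hq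
    have h2 : q'.1 ∘ p.1 =ᵐ[Ω.P] q'.1 ∘ p'.1 := hp.fun_comp q'.1
    exact h1.trans h2

instance : Category.{u} SBP₀.{u} where
  Hom := SBP₀.Hom
  id Ω := SBP₀.homMk id (MeasurePreserving.id Ω.P)
  comp := SBP₀.comp
  id_comp f := by induction f using Quotient.inductionOn; rfl
  comp_id f := by induction f using Quotient.inductionOn; rfl
  assoc f g h := by
    induction f using Quotient.inductionOn
    induction g using Quotient.inductionOn
    induction h using Quotient.inductionOn
    rfl

section RV

variable (A : Type u) [MeasurableSpace A]

/-- Random variables `Ω → A` modulo almost sure equality. -/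
def RVObj (Ω : SBP₀.{u}) : Type u := _root_.Quotient (rvSetoid Ω.P A)

variable {A} in
/-- The class `[X]` of a random variable. -/
def RVObj.mk {Ω : SBP₀.{u}} (X : Ω.carrier → A) (hX : Measurable X) : RVObj A Ω :=
  Quotient.mk (rvSetoid Ω.P A) ⟨X, hX⟩

variable {A} in
/-- `[X] · [q] = [X ∘ q]`. -/
def RVObj.restrict {Ω Ω' : SBP₀.{u}} : (Ω' ⟶ Ω) → RVObj A Ω → RVObj A Ω' :=
  Quotient.map₂ (fun q X => ⟨X.1 ∘ q.1, X.2.comp q.2.measurable⟩) fun q q' hq X X' hX => by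
    have h1 : X.1 ∘ q.1 =ᵐ[Ω'.P] X'.1 ∘ q.1 := q.2.quasiMeasurePreserving.ae_eq_comp hX
    have h2 : X'.1 ∘ q.1 =ᵐ[Ω'.P] X'.1 ∘ q'.1 := hq.fun_comp X'.1
    exact h1.trans h2

/-- The presheaf of `A`-valued random variables modulo almost sure equality. -/
def RV : SBP₀.{u}ᵒᵖ ⥤ Type u where
  obj Ω := RVObj A Ω.unop
  map q := TypeCat.ofHom (RVObj.restrict q.unop)
  map_id Ω := by
    ext x
    induction x using Quotient.inductionOn
    rfl
  map_comp {Ω Ω' Ω''} q q' := by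
    ext x
    obtain ⟨q, rfl⟩ : ∃ f, Quiver.Hom.op f = q := ⟨q.unop, rfl⟩
    obtain ⟨q', rfl⟩ : ∃ f, Quiver.Hom.op f = q' := ⟨q'.unop, rfl⟩
    induction x using Quotient.inductionOn
    induction q using Quotient.inductionOn
    induction q' using Quotient.inductionOn
    rfl

end RV

/-- The independent squares of `SBP₀`: the commuting squares `r ∘ p = s ∘ q` such that `p` and `q`
are conditionally independent given `r ∘ p`. -/
def indepSquare : AtomicSheaves.SquareClass SBP₀.{u} := fun Ω Ω₁ Ω₂ Ω₃ p q r s =>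
  p ≫ r = q ≫ s ∧
    ∃ (p₀ : Ω.carrier → Ω₁.carrier) (q₀ : Ω.carrier → Ω₂.carrier) (r₀ : Ω₁.carrier → Ω₃.carrier)
      (hp : MeasurePreserving p₀ Ω.P Ω₁.P) (hq : MeasurePreserving q₀ Ω.P Ω₂.P)
      (hr : MeasurePreserving r₀ Ω₁.P Ω₃.P),
      SBP₀.homMk p₀ hp = p ∧ SBP₀.homMk q₀ hq = q ∧ SBP₀.homMk r₀ hr = r ∧
        CondIndepRV Ω.P p₀ q₀ (r₀ ∘ p₀)

end ProbabilitySheaves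

/-! Everything rests on disintegrations. They exist and are almost surely unique over standard Borel
spaces, and two of them over a common base multiply to the relatively independent coupling, which
completes any cospan. Essential smallness holds because every object is isomorphic to the real line
with some probability measure.

The sheaf property uses the self-coupling of a map `c`: an invariant variable agrees on the two
projections, hence is almost surely constant on almost every fibre of `c`, hence factors through `c`
(`exists_comp_ae_eq_of_coupling`). The support of a random variable is its law.

For independence, an independent square over a support of `Z` conditions on a variable carrying the
same information as `Z`, so `X ⊥ Y | Z` follows by taking functions (`CondIndepRV.of_ae_eq_comp`).
Conversely the laws of `(X, Z)` and `(Y, Z)` over the law of `Z` form such a square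
(`CondIndepRV.prodMk`). The subsheaf property then reduces to invariance of `X ⊥ Y | Z` under
measure preserving maps, in both directions (`condIndepRV_comp_iff`). -/

namespace ProbabilitySheaves

/-! ### Disintegrations: existence, uniqueness, pushforward -/

section Disintegration

variable {Ω Ω' A B D A' B' D' : Type*} [MeasurableSpace Ω] [MeasurableSpace Ω']
  [MeasurableSpace A] [MeasurableSpace B] [MeasurableSpace D]
  [MeasurableSpace A'] [MeasurableSpace B'] [MeasurableSpace D']
  {P : Measure Ω} {P' : Measure Ω'} {Z : Ω → D} {K : Kernel D Ω}

theorem IsDisintegration.comp_eq (h : IsDisintegration P Z K) : K ∘ₘ P.map Z = P := by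
  ext S hS
  rw [Measure.bind_apply hS K.aemeasurable, h.average S hS]

theorem IsDisintegration.ae_ae (h : IsDisintegration P Z K) {p : Ω → Prop} (hp : ∀ᵐ ω ∂P, p ω) :
    ∀ᵐ z ∂P.map Z, ∀ᵐ ω ∂K z, p ω :=
  Measure.ae_ae_of_ae_comp (by rwa [h.comp_eq])

theorem IsDisintegration.ae_of_ae_ae (h : IsDisintegration P Z K) {p : Ω → Prop}
    (hm : MeasurableSet {ω | p ω}) (hp : ∀ᵐ z ∂P.map Z, ∀ᵐ ω ∂K z, p ω) : ∀ᵐ ω ∂P, p ω := by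
  rw [← h.comp_eq]
  exact (Measure.ae_comp_iff hm).2 hp

theorem IsDisintegration.ae_fibre [MeasurableSingletonClass D] (hZ : Measurable Z)
    (h : IsDisintegration P Z K) : ∀ᵐ z ∂P.map Z, ∀ᵐ ω ∂K z, Z ω = z := by
  have := h.isMarkov
  filter_upwards [h.fibre] with z hz
  exact (mem_ae_iff_prob_eq_one (hZ (measurableSet_singleton z))).2 hz

theorem IsDisintegration.of_ae_fibre [MeasurableSingletonClass D] (hZ : Measurable Z)
    [IsMarkovKernel K] (hf : ∀ᵐ z ∂P.map Z, ∀ᵐ ω ∂K z, Z ω = z) (hK : K ∘ₘ P.map Z = P) :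
    IsDisintegration P Z K where
  isMarkov := inferInstance
  fibre := by
    filter_upwards [hf] with z hz
    exact (mem_ae_iff_prob_eq_one (hZ (measurableSet_singleton z))).1 hz
  average S hS := by
    conv_lhs => rw [← hK]
    rw [Measure.bind_apply hS K.aemeasurable]

/-- Since `K z` lives on the fibre over `z`, integrating it gives the law on the graph of `Z`. This
law does not mention `K`, whence uniqueness. -/
theorem IsDisintegration.compProd_eq [MeasurableSingletonClass D] [SFinite P] (hZ : Measurable Z)
    (h : IsDisintegration P Z K) : P.map Z ⊗ₘ K = P.map fun ω => (Z ω, ω) := by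
  have := h.isMarkov
  have hm : Measurable fun ω => (Z ω, ω) := hZ.prodMk measurable_id
  ext S hS
  rw [Measure.compProd_apply hS, Measure.map_apply hm hS, h.average _ (hm hS)]
  refine lintegral_congr_ae ?_
  filter_upwards [h.ae_fibre hZ] with z hz
  refine measure_congr ?_
  filter_upwards [hz] with ω hω
  change ((z, ω) ∈ S) = ((Z ω, ω) ∈ S)
  rw [hω]

/-- Disintegrations are almost surely unique. -/
theorem IsDisintegration.ae_eq [StandardBorelSpace Ω] [MeasurableSingletonClass D]
    [IsFiniteMeasure P] (hZ : Measurable Z) {K' : Kernel D Ω} (h : IsDisintegration P Z K)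
    (h' : IsDisintegration P Z K') : K =ᵐ[P.map Z] K' := by
  have := h.isMarkov
  have := h'.isMarkov
  exact Kernel.ae_eq_of_compProd_eq ((h.compProd_eq hZ).trans (h'.compProd_eq hZ).symm)

/-- The conditional distribution of the identity given `Z` works: the joint law of `(Z, id)` is
carried by the graph of `Z`, which forces the fibre condition. -/
theorem exists_isDisintegration [StandardBorelSpace Ω] [StandardBorelSpace D]
    [IsProbabilityMeasure P] (hZ : Measurable Z) : ∃ K, IsDisintegration P Z K := by
  have : Nonempty Ω := nonempty_of_isProbabilityMeasure P
  have h := compProd_map_condDistrib (mβ := ‹_›) (μ := P) (X := Z) (Y := id) aemeasurable_id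
  have hm : Measurable fun ω => (Z ω, id ω) := hZ.prodMk measurable_id
  refine ⟨condDistrib id Z P, .of_ae_fibre hZ ?_ ?_⟩
  · have hs : MeasurableSet {x : D × Ω | Z x.2 = x.1} :=
      measurableSet_eq_fun (hZ.comp measurable_snd) measurable_fst
    refine (Measure.ae_compProd_iff (p := fun x : D × Ω => Z x.2 = x.1) hs).1 ?_
    rw [h, ae_map_iff hm.aemeasurable hs]
    exact .of_forall fun _ => rfl
  · rw [← Measure.snd_compProd, h, Measure.snd, Measure.map_map measurable_snd hm]
    exact Measure.map_id

/-- A disintegration pushes forward along a measure preserving map. -/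
theorem IsDisintegration.map [MeasurableSingletonClass D] (hZ : Measurable Z) {T : Ω' → Ω}
    (hT : MeasurePreserving T P' P) {K : Kernel D Ω'} (h : IsDisintegration P' (Z ∘ T) K) :
    IsDisintegration P Z (K.map T) := by
  have := h.isMarkov
  have := Kernel.IsMarkovKernel.map K hT.measurable
  have hmap : P'.map (Z ∘ T) = P.map Z := by
    rw [← Measure.map_map hZ hT.measurable, hT.map_eq]
  refine .of_ae_fibre hZ ?_ ?_
  · filter_upwards [hmap ▸ h.ae_fibre (hZ.comp hT.measurable)] with z hz
    rw [Kernel.map_apply _ hT.measurable]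
    exact (ae_map_iff hT.measurable.aemeasurable (hZ (measurableSet_singleton z))).2 hz
  · rw [← Measure.map_comp _ _ hT.measurable, ← hmap, h.comp_eq, hT.map_eq]

/-! ### Conditional independence of random variables -/

section CondIndep

theorem indepFun_map_iff {T : Ω' → Ω} (hT : Measurable T) {μ : Measure Ω'}
    {X : Ω → A} {Y : Ω → B} (hX : Measurable X) (hY : Measurable Y) :
    IndepFun X Y (μ.map T) ↔ IndepFun (X ∘ T) (Y ∘ T) μ := by
  rw [indepFun_iff_measure_inter_preimage_eq_mul, indepFun_iff_measure_inter_preimage_eq_mul]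
  refine forall₄_congr fun S U hS hU => ?_
  rw [Measure.map_apply hT ((hX hS).inter (hY hU)), Measure.map_apply hT (hX hS),
    Measure.map_apply hT (hY hU)]
  rfl

variable [StandardBorelSpace A] [StandardBorelSpace B]
  {X : Ω → A} {Y : Ω → B}

/-- The point is one null set serving all pairs `S, T` at once. Independence is restated as equality
of two kernels into `A × B`, and almost everywhere uniqueness of kernels into a standard Borel space
supplies that null set. -/
theorem condIndepRV_iff [IsFiniteMeasure P] (hX : Measurable X) (hY : Measurable Y) :
    CondIndepRV P X Y Z ↔
      ∃ K, IsDisintegration P Z K ∧ ∀ᵐ z ∂P.map Z, IndepFun X Y (K z) := by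
  refine exists_congr fun K => and_congr_right fun h => ?_
  have := h.isMarkov
  rw [← Kernel.indepFun_iff_measure_inter_preimage_eq_mul]
  constructor
  · intro hi
    rw [Kernel.indepFun_iff_compProd_map_prod_eq_compProd_prod_map_map hX hY] at hi
    have := Kernel.IsMarkovKernel.map K hX
    have := Kernel.IsMarkovKernel.map K hY
    have := Kernel.IsMarkovKernel.map K (hX.prodMk hY)
    filter_upwards [Kernel.ae_eq_of_compProd_eq hi] with z hz
    rw [indepFun_iff_map_prod_eq_prod_map_map hX.aemeasurable hY.aemeasurable]
    rwa [Kernel.map_apply _ (hX.prodMk hY), Kernel.prod_apply, Kernel.map_apply _ hX,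
      Kernel.map_apply _ hY] at hz
  · intro hi
    rw [Kernel.indepFun_iff_measure_inter_preimage_eq_mul]
    intro S T hS hT
    filter_upwards [hi] with z hz
    exact hz.measure_inter_preimage_eq_mul S T hS hT

/-- Conditional independence passes to functions of the independent variables, and to a
conditioning variable carrying the same information. -/
theorem CondIndepRV.of_ae_eq_comp [IsFiniteMeasure P]
    [StandardBorelSpace A'] [StandardBorelSpace B'] [StandardBorelSpace D] [StandardBorelSpace D']
    {X' : Ω → A'} {Y' : Ω → B'} {Z' : Ω → D'} (h : CondIndepRV P X' Y' Z')
    (hX : Measurable X) (hY : Measurable Y) (hZ : Measurable Z)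
    (hX' : Measurable X') (hY' : Measurable Y') (hZ' : Measurable Z')
    {f : A' → A} {g : B' → B} {e : D' → D} {k : D → D'}
    (hf : Measurable f) (hg : Measurable g) (he : Measurable e) (hk : Measurable k)
    (hXf : X =ᵐ[P] f ∘ X') (hYg : Y =ᵐ[P] g ∘ Y') (hZe : Z =ᵐ[P] e ∘ Z')
    (hZk : Z' =ᵐ[P] k ∘ Z) : CondIndepRV P X Y Z := by
  obtain ⟨K, hK, hi⟩ := (condIndepRV_iff hX' hY').1 h
  have := hK.isMarkov
  have hmap : P.map Z' = (P.map Z).map k := by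
    rw [Measure.map_map hk hZ, Measure.map_congr hZk]
  have hpull {p : D' → Prop} (hp : ∀ᵐ w ∂P.map Z', p w) : ∀ᵐ z ∂P.map Z, p (k z) :=
    ae_of_ae_map hk.aemeasurable (hmap ▸ hp)
  -- `e` inverts `k` almost surely on the law of `Z`, so reindexing `K` along `k` disintegrates
  -- along `Z`.
  have hek : ∀ᵐ z ∂P.map Z, e (k z) = z := by
    refine (ae_map_iff hZ.aemeasurable (measurableSet_eq_fun (he.comp hk) measurable_id)).2 ?_
    filter_upwards [hZe, hZk] with ω h1 h2
    rw [Function.comp_apply] at h1 h2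
    rw [Function.comp_apply, ← h2, ← h1, id]
  refine (condIndepRV_iff hX hY).2 ⟨K.comap k hk, .of_ae_fibre hZ ?_ ?_, ?_⟩
  · filter_upwards [hek, hpull (hK.ae_fibre hZ'), hpull (hK.ae_ae hZe)] with z h1 h2 h3
    rw [Kernel.comap_apply]
    filter_upwards [h2, h3] with ω h4 h5
    rw [h5, Function.comp_apply, h4, h1]
  · ext S hS
    rw [Measure.bind_apply hS (Kernel.aemeasurable _), hK.average S hS, hmap,
      lintegral_map (K.measurable_coe hS) hk]
    rfl
  · filter_upwards [hpull hi, hpull (hK.ae_ae hXf), hpull (hK.ae_ae hYg)] with z h1 h2 h3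
    rw [Kernel.comap_apply]
    exact (h1.comp hf hg).congr (Filter.EventuallyEq.symm h2) (Filter.EventuallyEq.symm h3)

/-- Conditional independence is invariant under measure preserving maps. -/
theorem condIndepRV_comp_iff [StandardBorelSpace Ω] [StandardBorelSpace Ω'] [StandardBorelSpace D]
    [IsProbabilityMeasure P] [IsProbabilityMeasure P'] {T : Ω' → Ω}
    (hT : MeasurePreserving T P' P) (hX : Measurable X) (hY : Measurable Y) (hZ : Measurable Z) :
    CondIndepRV P' (X ∘ T) (Y ∘ T) (Z ∘ T) ↔ CondIndepRV P X Y Z := by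
  have hmap : P'.map (Z ∘ T) = P.map Z := by
    rw [← Measure.map_map hZ hT.measurable, hT.map_eq]
  rw [condIndepRV_iff (hX.comp hT.measurable) (hY.comp hT.measurable), condIndepRV_iff hX hY, hmap]
  constructor
  · rintro ⟨K, hK, hi⟩
    refine ⟨K.map T, hK.map hZ hT, ?_⟩
    filter_upwards [hi] with z hz
    rw [Kernel.map_apply _ hT.measurable]
    exact (indepFun_map_iff hT.measurable hX hY).2 hz
  · rintro ⟨K, hK, hi⟩
    -- The kernel on `Ω` cannot be lifted directly; any disintegration upstairs pushes forward to
    -- one downstairs, which uniqueness identifies with `K`.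
    obtain ⟨K', hK'⟩ := exists_isDisintegration (P := P') (hZ.comp hT.measurable)
    refine ⟨K', hK', ?_⟩
    filter_upwards [hi, (hK'.map hZ hT).ae_eq hZ hK] with z hz h
    rw [← h, Kernel.map_apply _ hT.measurable] at hz
    exact (indepFun_map_iff hT.measurable hX hY).1 hz

/-- Adjoining the conditioning variable to both independent variables preserves conditional
independence. -/
theorem CondIndepRV.prodMk [StandardBorelSpace D] [IsFiniteMeasure P] (h : CondIndepRV P X Y Z)
    (hX : Measurable X) (hY : Measurable Y) (hZ : Measurable Z) :
    CondIndepRV P (fun ω => (X ω, Z ω)) (fun ω => (Y ω, Z ω)) Z := by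
  obtain ⟨K, hK, hi⟩ := (condIndepRV_iff hX hY).1 h
  refine (condIndepRV_iff (hX.prodMk hZ) (hY.prodMk hZ)).2 ⟨K, hK, ?_⟩
  filter_upwards [hi, hK.ae_fibre hZ] with z hz hf
  -- Under `K z` the variable `Z` is the constant `z`, so each pair is a function of its first
  -- entry.
  refine (hz.comp (measurable_prodMk_right (y := z)) (measurable_prodMk_right (y := z))).congr
    ?_ ?_ <;> filter_upwards [hf] with ω hω <;> simp [hω]

end CondIndep

end Disintegration

/-! ### Relatively independent couplings -/

section Coupling

variable {Ω Ω₁ Ω₂ A : Type*} [MeasurableSpace Ω] [MeasurableSpace Ω₁] [MeasurableSpace Ω₂]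
  [MeasurableSpace A] {P : Measure Ω} {P₁ : Measure Ω₁} {P₂ : Measure Ω₂}
  {f : Ω₁ → Ω} {g : Ω₂ → Ω} {K₁ : Kernel Ω Ω₁} {K₂ : Kernel Ω Ω₂}

theorem measurePreserving_fst_coupling (hf : MeasurePreserving f P₁ P)
    (h₁ : IsDisintegration P₁ f K₁) (h₂ : IsDisintegration P₂ g K₂) :
    MeasurePreserving Prod.fst ((K₁ ×ₖ K₂) ∘ₘ P) P₁ where
  measurable := measurable_fst
  map_eq := by
    have := h₁.isMarkov
    have := h₂.isMarkov
    rw [Measure.map_comp _ _ measurable_fst, ← Kernel.fst_eq, Kernel.fst_prod, ← hf.map_eq,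
      h₁.comp_eq]

theorem measurePreserving_snd_coupling (hg : MeasurePreserving g P₂ P)
    (h₁ : IsDisintegration P₁ f K₁) (h₂ : IsDisintegration P₂ g K₂) :
    MeasurePreserving Prod.snd ((K₁ ×ₖ K₂) ∘ₘ P) P₂ where
  measurable := measurable_snd
  map_eq := by
    have := h₁.isMarkov
    have := h₂.isMarkov
    rw [Measure.map_comp _ _ measurable_snd, ← Kernel.snd_eq, Kernel.snd_prod, ← hg.map_eq,
      h₂.comp_eq]

theorem ae_coupling [StandardBorelSpace Ω] (hf : MeasurePreserving f P₁ P)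
    (hg : MeasurePreserving g P₂ P) (h₁ : IsDisintegration P₁ f K₁)
    (h₂ : IsDisintegration P₂ g K₂) : ∀ᵐ x ∂((K₁ ×ₖ K₂) ∘ₘ P), f x.1 = g x.2 := by
  have := h₁.isMarkov
  have := h₂.isMarkov
  refine (Measure.ae_comp_iff (measurableSet_eq_fun (hf.measurable.comp measurable_fst)
    (hg.measurable.comp measurable_snd))).2 ?_
  filter_upwards [hf.map_eq ▸ h₁.ae_fibre hf.measurable,
    hg.map_eq ▸ h₂.ae_fibre hg.measurable] with x hx₁ hx₂
  rw [Kernel.prod_apply]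
  filter_upwards [Measure.quasiMeasurePreserving_fst.ae hx₁,
    Measure.quasiMeasurePreserving_snd.ae hx₂] with y hy₁ hy₂
  exact hy₁.trans hy₂.symm

/-- A random variable agreeing almost surely on both legs of the relatively independent
self-coupling of `f` factors through `f`. -/
theorem exists_comp_ae_eq_of_coupling [StandardBorelSpace Ω] [StandardBorelSpace A] [Nonempty A]
    (hf : MeasurePreserving f P₁ P) (h₁ : IsDisintegration P₁ f K₁)
    {Y : Ω₁ → A} (hY : Measurable Y) (h : ∀ᵐ x ∂((K₁ ×ₖ K₁) ∘ₘ P), Y x.1 = Y x.2) :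
    ∃ X : Ω → A, Measurable X ∧ X ∘ f =ᵐ[P₁] Y := by
  have := h₁.isMarkov
  -- The factor is the fibrewise mean of `Y`, computed in `ℝ` through `φ` and brought back by its
  -- left inverse `ψ`. No integrability is needed, as `Y` is almost surely constant on almost every
  -- fibre.
  obtain ⟨φ, hφ⟩ := exists_measurableEmbedding_real A
  obtain ⟨ψ, hψ, hψφ⟩ := hφ.exists_measurable_extend (measurable_id (α := A))
    fun _ => inferInstance
  have hX : Measurable fun ω => ψ (∫ a, φ (Y a) ∂K₁ ω) :=
    hψ.comp (hφ.measurable.comp hY).stronglyMeasurable.integral_kernel.measurable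
  refine ⟨_, hX, ?_⟩
  refine h₁.ae_of_ae_ae (measurableSet_eq_fun (hX.comp hf.measurable) hY) ?_
  have h' := Measure.ae_ae_of_ae_comp h
  rw [hf.map_eq]
  filter_upwards [h', hf.map_eq ▸ h₁.ae_fibre hf.measurable] with ω hω hfω
  rw [Kernel.prod_apply] at hω
  filter_upwards [Measure.ae_ae_of_ae_prod hω, hfω] with a ha hfa
  rw [Function.comp_apply, hfa, integral_congr_ae (g := fun _ => φ (Y a))
    (by filter_upwards [ha] with b hb; rw [hb])]
  simpa using congrFun hψφ (Y a)

end Coupling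

/-! ### Representatives, essential smallness and completion of cospans -/

section Representatives

variable {Ω Ω' : SBP₀.{u}}

theorem SBP₀.exists_homMk_eq (f : Ω ⟶ Ω') :
    ∃ (q : Ω.carrier → Ω'.carrier) (hq : MeasurePreserving q Ω.P Ω'.P), homMk q hq = f := by
  obtain ⟨⟨q, hq⟩, rfl⟩ := Quotient.exists_rep f
  exact ⟨q, hq, rfl⟩

theorem SBP₀.homMk_eq_iff {p q : Ω.carrier → Ω'.carrier} (hp : MeasurePreserving p Ω.P Ω'.P)
    (hq : MeasurePreserving q Ω.P Ω'.P) : homMk p hp = homMk q hq ↔ p =ᵐ[Ω.P] q :=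
  Quotient.eq

variable {A : Type u} [MeasurableSpace A]

theorem RVObj.exists_mk_eq (x : RVObj A Ω) : ∃ (X : Ω.carrier → A) (hX : Measurable X),
    mk X hX = x := by
  obtain ⟨⟨X, hX⟩, rfl⟩ := Quotient.exists_rep x
  exact ⟨X, hX, rfl⟩

theorem RVObj.mk_eq_iff {X Y : Ω.carrier → A} (hX : Measurable X) (hY : Measurable Y) :
    mk X hX = mk Y hY ↔ X =ᵐ[Ω.P] Y :=
  Quotient.eq

theorem RV_map_homMk {q : Ω.carrier → Ω'.carrier} (hq : MeasurePreserving q Ω.P Ω'.P)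
    {X : Ω'.carrier → A} (hX : Measurable X) :
    (RV A).map (Quiver.Hom.op (V := SBP₀) (SBP₀.homMk q hq)) (RVObj.mk X hX) =
      RVObj.mk (X ∘ q) (hX.comp hq.measurable) :=
  rfl

end Representatives

/-- The real line with a probability measure, as an object of `SBP₀`. -/
def realSpace (μ : {μ : Measure (ULift.{u} ℝ) // IsProbabilityMeasure μ}) : SBP₀.{u} :=
  have := μ.2
  have : PolishSpace (ULift.{u} ℝ) := Homeomorph.ulift.isClosedEmbedding.polishSpace
  { carrier := ULift.{u} ℝ, P := μ.1 }

theorem exists_iso_realSpace (Ω : SBP₀.{u}) : ∃ μ, Nonempty (Ω ≅ realSpace.{u} μ) := by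
  have : Nonempty Ω.carrier := nonempty_of_isProbabilityMeasure Ω.P
  obtain ⟨φ₀, hφ₀⟩ := exists_measurableEmbedding_real Ω.carrier
  obtain ⟨φ, hφ⟩ : ∃ φ : Ω.carrier → ULift.{u} ℝ, MeasurableEmbedding φ :=
    ⟨_, MeasurableEquiv.ulift.symm.measurableEmbedding.comp hφ₀⟩
  obtain ⟨ψ, hψ, hψφ⟩ := hφ.exists_measurable_extend measurable_id fun _ => inferInstance
  have hp : MeasurePreserving φ Ω.P (Ω.P.map φ) := ⟨hφ.measurable, rfl⟩
  have hq : MeasurePreserving ψ (Ω.P.map φ) Ω.P :=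
    ⟨hψ, by rw [Measure.map_map hψ hφ.measurable, hψφ, Measure.map_id]⟩
  let R : SBP₀.{u} :=
    realSpace ⟨Ω.P.map φ, Measure.isProbabilityMeasure_map hφ.measurable.aemeasurable⟩
  refine ⟨_, ⟨⟨SBP₀.homMk (Ω' := R) φ hp, SBP₀.homMk (Ω := R) ψ hq, ?_, ?_⟩⟩⟩
  · exact (SBP₀.homMk_eq_iff _ (MeasurePreserving.id _)).2 (.of_forall (congrFun hψφ))
  · refine (SBP₀.homMk_eq_iff _ (MeasurePreserving.id _)).2 ?_
    -- `φ` need not be surjective, but its image has full measure and there `φ ∘ ψ` is the identity.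
    refine (ae_map_iff (p := fun x => φ (ψ x) = x) hφ.measurable.aemeasurable
      (measurableSet_eq_fun (hφ.measurable.comp hψ) measurable_id)).2 (.of_forall fun ω => ?_)
    exact congrArg φ (congrFun hψφ ω)

theorem essentiallySmall_SBP₀ : EssentiallySmall.{u} SBP₀.{u} := by
  refine (essentiallySmall_iff _).2 ⟨?_, inferInstance⟩
  refine small_of_surjective (f := fun μ => toSkeleton (realSpace.{u} μ)) fun s => ?_
  obtain ⟨μ, ⟨i⟩⟩ := exists_iso_realSpace ((fromSkeleton SBP₀.{u}).obj s)
  refine ⟨μ, ?_⟩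
  have h : toSkeleton ((fromSkeleton SBP₀.{u}).obj s) = s := Quotient.out_eq s
  rw [← h]
  exact (congr_toSkeleton_of_iso i).symm

/-- A disintegration along a measure preserving map. -/
theorem SBP₀.exists_isDisintegration {Ω Ω' : SBP₀.{u}} {q : Ω.carrier → Ω'.carrier}
    (hq : MeasurePreserving q Ω.P Ω'.P) :
    ∃ K : Kernel Ω'.carrier Ω.carrier, IsDisintegration Ω.P q K :=
  ProbabilitySheaves.exists_isDisintegration hq.measurable

/-- The relatively independent coupling of two spaces over a third one. -/
noncomputable def SBP₀.coupling {Ω Ω₁ Ω₂ : SBP₀.{u}} (K₁ : Kernel Ω.carrier Ω₁.carrier)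
    (K₂ : Kernel Ω.carrier Ω₂.carrier) [IsMarkovKernel K₁] [IsMarkovKernel K₂] : SBP₀.{u} where
  carrier := Ω₁.carrier × Ω₂.carrier
  P := (K₁ ×ₖ K₂) ∘ₘ Ω.P

theorem rightOreCondition_SBP₀ : GrothendieckTopology.RightOreCondition SBP₀.{u} := by
  intro Ω Ω₁ Ω₂ f g
  obtain ⟨f, hf, rfl⟩ := SBP₀.exists_homMk_eq f
  obtain ⟨g, hg, rfl⟩ := SBP₀.exists_homMk_eq g
  obtain ⟨K₁, h₁⟩ := SBP₀.exists_isDisintegration hf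
  obtain ⟨K₂, h₂⟩ := SBP₀.exists_isDisintegration hg
  have := h₁.isMarkov
  have := h₂.isMarkov
  exact ⟨SBP₀.coupling K₁ K₂,
    SBP₀.homMk (Ω := SBP₀.coupling K₁ K₂) Prod.fst (measurePreserving_fst_coupling hf h₁ h₂),
    SBP₀.homMk (Ω := SBP₀.coupling K₁ K₂) Prod.snd (measurePreserving_snd_coupling hg h₁ h₂),
    (SBP₀.homMk_eq_iff _ _).2 (ae_coupling hf hg h₁ h₂)⟩

/-! ### Random variables: sheaf property and supports -/

section RV

variable {A : Type u} [MeasurableSpace A] [StandardBorelSpace A]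

/-- Restriction of random variables along a morphism is injective. -/
theorem RV_map_injective {Ω Ω' : SBP₀.{u}} (c : Ω' ⟶ Ω) :
    Function.Injective ((RV A).map c.op) := by
  intro x x' h
  obtain ⟨c, hc, rfl⟩ := SBP₀.exists_homMk_eq c
  obtain ⟨X, hX, rfl⟩ := RVObj.exists_mk_eq x
  obtain ⟨X', hX', rfl⟩ := RVObj.exists_mk_eq x'
  rw [RV_map_homMk, RV_map_homMk] at h
  have h := (RVObj.mk_eq_iff _ _).1 h
  refine (RVObj.mk_eq_iff _ _).2 ?_
  have hm := measurableSet_eq_fun hX hX'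
  change ∀ᵐ ω ∂Ω.P, X ω = X' ω
  rw [← hc.map_eq, ae_map_iff hc.aemeasurable hm]
  exact h

theorem isAtomicSheaf_RV : AtomicSheaves.IsAtomicSheaf (RV A) := by
  intro Ω Ω' c y hy
  refine existsUnique_of_exists_of_unique ?_
    fun x x' hx hx' => RV_map_injective c (hx.trans hx'.symm)
  obtain ⟨c, hc, rfl⟩ := SBP₀.exists_homMk_eq c
  obtain ⟨Y, hY, rfl⟩ := RVObj.exists_mk_eq y
  obtain ⟨K, hK⟩ := SBP₀.exists_isDisintegration hc
  have := hK.isMarkov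
  have : Nonempty A := (nonempty_of_isProbabilityMeasure Ω'.P).map Y
  -- Invariance is needed only for the two projections of the self-coupling.
  have h := hy (Z := SBP₀.coupling K K)
    (SBP₀.homMk (Ω := SBP₀.coupling K K) Prod.fst (measurePreserving_fst_coupling hc hK hK))
    (SBP₀.homMk (Ω := SBP₀.coupling K K) Prod.snd (measurePreserving_snd_coupling hc hK hK))
    ((SBP₀.homMk_eq_iff _ _).2 (ae_coupling hc hc hK hK))
  obtain ⟨X, hX, hXY⟩ := exists_comp_ae_eq_of_coupling hc hK hY ((RVObj.mk_eq_iff _ _).1 h)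
  exact ⟨RVObj.mk X hX, (RVObj.mk_eq_iff _ _).2 hXY⟩

/-- The law of a random variable, as an object of `SBP₀`. -/
noncomputable def lawSpace {Ω : SBP₀.{u}} (X : Ω.carrier → A) (hX : Measurable X) : SBP₀.{u} :=
  have := Measure.isProbabilityMeasure_map (μ := Ω.P) hX.aemeasurable
  { carrier := A, P := Ω.P.map X }

/-- A random variable as a morphism to its law. -/
noncomputable def toLaw {Ω : SBP₀.{u}} (X : Ω.carrier → A) (hX : Measurable X) : Ω ⟶ lawSpace X hX :=
  SBP₀.homMk (Ω' := lawSpace X hX) X ⟨hX, rfl⟩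

/-- The canonical factorisation of a random variable through its law. -/
noncomputable def lawFactorisation {Ω : SBP₀.{u}} (X : Ω.carrier → A) (hX : Measurable X) :
    AtomicSheaves.RepFactorisation (RV A) (X := Ω) (RVObj.mk X hX) where
  obj := lawSpace X hX
  map := toLaw X hX
  elt := RVObj.mk (Ω := lawSpace X hX) id measurable_id
  fac := rfl

/-- In a factorisation `X = X' ∘ q`, the variable `X'` has the law of `X`, so it is itself the
required morphism. It is unique because the element on the law is the identity. -/
theorem isSupport_lawFactorisation {Ω : SBP₀.{u}} (X : Ω.carrier → A) (hX : Measurable X) :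
    (lawFactorisation X hX).IsSupport := by
  rintro ⟨Ω', q, x', fac⟩
  obtain ⟨q, hq, rfl⟩ := SBP₀.exists_homMk_eq q
  obtain ⟨X', hX', rfl⟩ := RVObj.exists_mk_eq x'
  have h : X' ∘ q =ᵐ[Ω.P] X := (RVObj.mk_eq_iff _ _).1 fac
  have hr : MeasurePreserving X' Ω'.P (Ω.P.map X) :=
    ⟨hX', by rw [← hq.map_eq, Measure.map_map hX' hq.measurable, Measure.map_congr h]⟩
  refine ⟨SBP₀.homMk (Ω' := lawSpace X hX) X' hr,
    ⟨(SBP₀.homMk_eq_iff _ _).2 h, rfl⟩, ?_⟩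
  rintro r ⟨-, hr'⟩
  obtain ⟨r, hr₀, rfl⟩ := SBP₀.exists_homMk_eq r
  exact (SBP₀.homMk_eq_iff _ _).2 ((RVObj.mk_eq_iff _ _).1 hr')

theorem hasSupports_RV : AtomicSheaves.HasSupports (RV A) := by
  intro Ω x
  obtain ⟨X, hX, rfl⟩ := RVObj.exists_mk_eq x
  exact ⟨_, isSupport_lawFactorisation X hX⟩

end RV

/-! ### Atomic versus probabilistic conditional independence -/

section CondIndep

variable {A B D : Type u} [MeasurableSpace A] [StandardBorelSpace A] [MeasurableSpace B]
  [StandardBorelSpace B] [MeasurableSpace D] [StandardBorelSpace D]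

theorem atomicCondIndep_RV_iff {Ω : SBP₀.{u}} {X : Ω.carrier → A} {Y : Ω.carrier → B}
    {Z : Ω.carrier → D} (hX : Measurable X) (hY : Measurable Y) (hZ : Measurable Z) :
    AtomicSheaves.AtomicCondIndep indepSquare (RV A) (RV B) (RV D) (X := Ω)
      (RVObj.mk X hX) (RVObj.mk Y hY) (RVObj.mk Z hZ) ↔ CondIndepRV Ω.P X Y Z := by
  constructor
  · rintro ⟨Ω₁, Ω₂, Ω₃, p, q, r, s, ⟨-, p, q, r, hp, hq, hr, rfl, rfl, rfl, hi⟩, x', -, y', -, z',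
      hx, hy, -, -, hz, hsupp⟩
    obtain ⟨X', hX', rfl⟩ := RVObj.exists_mk_eq x'
    obtain ⟨Y', hY', rfl⟩ := RVObj.exists_mk_eq y'
    obtain ⟨Z', hZ', rfl⟩ := RVObj.exists_mk_eq z'
    -- Terminality of the support recovers `r ∘ p` from `Z`, while `z'` recovers `Z` from `r ∘ p`.
    obtain ⟨k, ⟨hk, -⟩, -⟩ := hsupp (lawFactorisation Z hZ)
    obtain ⟨k, hk₀, rfl⟩ := SBP₀.exists_homMk_eq k
    have hk : k ∘ Z =ᵐ[Ω.P] r ∘ p := (SBP₀.homMk_eq_iff _ _).1 hk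
    exact hi.of_ae_eq_comp hX hY hZ hp.measurable hq.measurable (hr.comp hp).measurable
      hX' hY' hZ' hk₀.measurable ((RVObj.mk_eq_iff _ _).1 hx).symm
      ((RVObj.mk_eq_iff _ _).1 hy).symm ((RVObj.mk_eq_iff _ _).1 hz).symm hk.symm
  · intro h
    have hXZ := hX.prodMk hZ
    have hYZ := hY.prodMk hZ
    have hr : MeasurePreserving Prod.snd (Ω.P.map fun ω => (X ω, Z ω)) (Ω.P.map Z) :=
      ⟨measurable_snd, Measure.map_map measurable_snd hXZ⟩
    have hs : MeasurePreserving Prod.snd (Ω.P.map fun ω => (Y ω, Z ω)) (Ω.P.map Z) :=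
      ⟨measurable_snd, Measure.map_map measurable_snd hYZ⟩
    exact ⟨lawSpace _ hXZ, lawSpace _ hYZ, lawSpace Z hZ, toLaw _ hXZ, toLaw _ hYZ,
      SBP₀.homMk (Ω := lawSpace _ hXZ) (Ω' := lawSpace Z hZ) Prod.snd hr,
      SBP₀.homMk (Ω := lawSpace _ hYZ) (Ω' := lawSpace Z hZ) Prod.snd hs,
      ⟨rfl, _, _, _, _, _, _, rfl, rfl, rfl, h.prodMk hX hY hZ⟩,
      RVObj.mk (Ω := lawSpace _ hXZ) Prod.fst measurable_fst, _,
      RVObj.mk (Ω := lawSpace _ hYZ) Prod.fst measurable_fst, _,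
      RVObj.mk (Ω := lawSpace Z hZ) id measurable_id, rfl, rfl, rfl, rfl, rfl,
      isSupport_lawFactorisation Z hZ⟩

theorem atomicCondIndep_RV_map_iff {Ω Ω' : SBP₀.{u}} (q : Ω' ⟶ Ω) (x : (RV A).obj (op Ω))
    (y : (RV B).obj (op Ω)) (z : (RV D).obj (op Ω)) :
    AtomicSheaves.AtomicCondIndep indepSquare (RV A) (RV B) (RV D)
      ((RV A).map q.op x) ((RV B).map q.op y) ((RV D).map q.op z) ↔
    AtomicSheaves.AtomicCondIndep indepSquare (RV A) (RV B) (RV D) x y z := by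
  obtain ⟨q, hq, rfl⟩ := SBP₀.exists_homMk_eq q
  obtain ⟨X, hX, rfl⟩ := RVObj.exists_mk_eq x
  obtain ⟨Y, hY, rfl⟩ := RVObj.exists_mk_eq y
  obtain ⟨Z, hZ, rfl⟩ := RVObj.exists_mk_eq z
  rw [RV_map_homMk, RV_map_homMk, RV_map_homMk, atomicCondIndep_RV_iff, atomicCondIndep_RV_iff]
  exact condIndepRV_comp_iff hq hX hY hZ

end CondIndep

end ProbabilitySheaves

/-! ### Products and subsheaves of atomic sheaves -/

namespace AtomicSheaves

variable {C : Type v} [Category.{w} C]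

theorem IsAtomicSheaf.prod {P Q : Cᵒᵖ ⥤ Type u} (hP : IsAtomicSheaf P) (hQ : IsAtomicSheaf Q) :
    IsAtomicSheaf (FunctorToTypes.prod P Q) := by
  rintro X Y c ⟨y₁, y₂⟩ hy
  obtain ⟨x₁, hx₁, hu₁⟩ := hP c y₁ fun Z d e h => congrArg Prod.fst (hy d e h)
  obtain ⟨x₂, hx₂, hu₂⟩ := hQ c y₂ fun Z d e h => congrArg Prod.snd (hy d e h)
  refine ⟨(x₁, x₂), Prod.ext hx₁ hx₂, ?_⟩
  rintro ⟨x₁', x₂'⟩ h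
  exact Prod.ext (hu₁ _ (congrArg Prod.fst h)) (hu₂ _ (congrArg Prod.snd h))

/-- A family of subsets which is stable under restriction and under descent is a subsheaf. -/
theorem IsAtomicSheaf.isSubsheaf {P : Cᵒᵖ ⥤ Type u} (hP : IsAtomicSheaf P)
    (Q : ∀ X : C, Set (P.obj (op X)))
    (hQ : ∀ ⦃X Y : C⦄ (c : Y ⟶ X) (x : P.obj (op X)), P.map c.op x ∈ Q Y ↔ x ∈ Q X) :
    IsSubsheaf P Q := by
  refine ⟨⟨fun X => Q X.unop, fun {X Y} i x hx => (hQ i.unop x).2 hx⟩, ?_, fun X => rfl⟩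
  rintro X Y c ⟨y, hy⟩ h
  obtain ⟨x, hx, hu⟩ := hP c y fun Z d e hde => congrArg Subtype.val (h d e hde)
  refine ⟨⟨x, (hQ c x).1 ?_⟩, Subtype.ext hx, ?_⟩
  · rw [hx]
    exact hy
  · rintro ⟨x', hx'⟩ h'
    exact Subtype.ext (hu x' (congrArg Subtype.val h'))

end AtomicSheaves

theorem proposition8p6 :
    EssentiallySmall.{u} ProbabilitySheaves.SBP₀.{u} ∧
    GrothendieckTopology.RightOreCondition ProbabilitySheaves.SBP₀.{u} ∧
    (∀ (A : Type u) [MeasurableSpace A] [StandardBorelSpace A],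
      AtomicSheaves.IsAtomicSheaf (ProbabilitySheaves.RV A) ∧
      AtomicSheaves.HasSupports (ProbabilitySheaves.RV A)) ∧
    (∀ (A B C : Type u) [MeasurableSpace A] [StandardBorelSpace A]
      [MeasurableSpace B] [StandardBorelSpace B] [MeasurableSpace C] [StandardBorelSpace C],
      AtomicSheaves.IsSubsheaf
        (FunctorToTypes.prod (ProbabilitySheaves.RV A)
          (FunctorToTypes.prod (ProbabilitySheaves.RV B) (ProbabilitySheaves.RV C)))
        (AtomicSheaves.atomicCondIndepSet ProbabilitySheaves.indepSquare
          (ProbabilitySheaves.RV A) (ProbabilitySheaves.RV B) (ProbabilitySheaves.RV C)) ∧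
      ∀ (Ω : ProbabilitySheaves.SBP₀.{u}) (X : Ω.carrier → A) (Y : Ω.carrier → B)
        (Z : Ω.carrier → C) (hX : Measurable X) (hY : Measurable Y) (hZ : Measurable Z),
        (ProbabilitySheaves.RVObj.mk X hX, ProbabilitySheaves.RVObj.mk Y hY,
            ProbabilitySheaves.RVObj.mk Z hZ) ∈
          AtomicSheaves.atomicCondIndepSet ProbabilitySheaves.indepSquare
            (ProbabilitySheaves.RV A) (ProbabilitySheaves.RV B) (ProbabilitySheaves.RV C) Ω ↔
        ProbabilitySheaves.CondIndepRV Ω.P X Y Z) := by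

  refine ⟨ProbabilitySheaves.essentiallySmall_SBP₀, ProbabilitySheaves.rightOreCondition_SBP₀,
    fun A _ _ => ⟨ProbabilitySheaves.isAtomicSheaf_RV, ProbabilitySheaves.hasSupports_RV⟩,
    fun A B C _ _ _ _ _ _ => ⟨?_, fun Ω X Y Z hX hY hZ =>
      ProbabilitySheaves.atomicCondIndep_RV_iff hX hY hZ⟩⟩
  exact (ProbabilitySheaves.isAtomicSheaf_RV.prod
    (ProbabilitySheaves.isAtomicSheaf_RV.prod ProbabilitySheaves.isAtomicSheaf_RV)).isSubsheaf _
    fun Ω Ω' q t => ProbabilitySheaves.atomicCondIndep_RV_map_iff q t.1 t.2.1 t.2.2
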